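/- **Setting.** Let $G$ be an ordered abelian group. A cut of $G$ is a pair $\Lambda=(\Lambda^L,\Lambda^R)$ with $G=\Lambda^L\sqcup\Lambda^R$ and $\lambda<\lambda'$ for all $\lambda\in\Lambda^L$, $\lambda'\in\Lambda^R$ (either part may be empty). Cuts are ordered by inclusion of their left parts. For $S\subseteq G$ let $S^+$ be the smallest cut whose left part contains $S$; put $\gamma^+=\{\gamma\}^+$ and $\Lambda+\Gamma=\{\lambda+\gamma:\lambda\in\Lambda^L,\gamma\in\Gamma^L\}^+$. For $\gamma\in G\cup\{\infty\}$ write $\gamma>\Lambda$ if $\gamma$ is larger than every element of $\Lambda^L$. Let $(K,v)$ be a valued field with value group $G$ that contains a subfield $k$ mapped isomorphically onto the residue field by the residue map, and let $t:G\to K^\ast$, $\gamma\mapsto t^\gamma$, be a value group section: $v(t^\gamma)=\gamma$ and $t^{-\gamma}=1/t^\gamma$ (it need not be a homomorphism). Write $\mathcal O_K[\Lambda]=\{x\in K: v(x)>\Lambda\}$, which contains $0$. A *tower of complements* for $K$ is a family $(A[\Lambda])_\Lambda$ of subsets of $K$, indexed by the cuts of $G$, such that for all cuts $\Lambda,\Gamma$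 and all $\gamma\in G$: 1. $A[\Lambda]$ is a $k$-subspace of $K$; 2. $A[\Lambda]\oplus\mathcal O_K[\Lambda]=K$; 3. $t^\gamma k\subseteq A[\gamma^+]$; 4. $\Gamma\le\Lambda$ if and only if $A[\Gamma]\subseteq A[\Lambda]$; 5. $A[\Lambda]\,A[\Gamma]\subseteq A[\Lambda+\Gamma]$. A sequence $(a_\nu)_{\nu\in I}$ in $K$, indexed by a nonempty well-ordered set $I$ without last element, is *pseudo-Cauchy* if $v(a_\sigma-a_\rho)<v(a_\tau-a_\sigma)$ for all $\rho<\sigma<\tau$. It is of *transcendental type* if for every $p\in K[X]$ the value $v(p(a_\nu))$ is eventually constant, where "eventually" means "for all $\nu\ge\nu_0$, for some $\nu_0\in I$". An element $a$ of a valued extension field is a *limit* of it if $v(a-a_\rho)=v(a_\sigma-a_\rho)$ for all $\rho<\sigma$. **Lemma.** Let $(A[\Lambda])_\Lambda$ be a tower of complements for $K$. Let $F=K(a)$ be an extension field of $K$ with a valuation $v:F\to G\cup\{\infty\}$ extending that of $K$, where $a$ is a limit of a pseudo-Cauchy sequence $(a_\nu)_{\nu\in I}$ in $K$ of transcendental type.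 Let $\Lambda_a=\{v(a-c):c\in K\}^+$, and write $a_\nu=a'_\nu+a''_\nu$ with $a'_\nu\in A[\Lambda_a]$ and $a''_\nu\in\mathcal O_K[\Lambda_a]$ (so $a'_\nu=a_\nu$ if already $a_\nu\in A[\Lambda_a]$). For every cut $\Gamma$ put $$C[\Gamma]=\{\,r(a): r\in K(X),\ r(a'_\nu)\in A[\Gamma]\text{ eventually}\,\}.$$ Then $k$ is also mapped isomorphically onto the residue field of $F$ and $t$ is a value group section of $F$, the family $(C[\Gamma])_\Gamma$ is a tower of complements for $F=K(a)$ (with respect to $k$ and $t$), and it extends the given one: $C[\Gamma]\cap K=A[\Gamma]$ for every cut $\Gamma$. -/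

import Mathlib

open scoped IntermediateField

namespace TowerComplements

section Cuts

variable {G : Type*} [AddCommGroup G] [LinearOrder G] [IsOrderedAddMonoid G]

/-- A cut `(Λ^L, Λ^R)` of the ordered group `G` is represented by its left part `Λ^L`, which is an
arbitrary lower set (`∅` and `G` included; `Λ^R` is the complement). The order is inclusion of left
parts, `-∞ = ⊥`, `+∞ = ⊤`. -/
abbrev Cut (G : Type*) [LinearOrder G] := LowerSet G

/-- The cut `γ⁺ = ((-∞, γ], (γ, +∞))`. -/
def Cut.plus (γ : G) : Cut G := LowerSet.Iic γ

/-- `S⁺` is the smallest cut whose left part contains `S`. -/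
def Cut.supPlus (S : Set G) : Cut G := lowerClosure S

/-- The left sum `Λ + Γ = {λ + γ : λ < Λ, γ < Γ}⁺` of two cuts. -/
def Cut.leftSum (Λ Γ : Cut G) : Cut G :=
  Cut.supPlus {x | ∃ l ∈ Λ, ∃ g ∈ Γ, x = l + g}

end Cuts

section ValuedFields

variable {G : Type*} [AddCommGroup G] [LinearOrder G] [IsOrderedAddMonoid G]
variable (k : Type*) {K : Type*} [Field k] [Field K] [Algebra k K]

/-- The subfield `k` of the valued field `(K, v)` is (via the residue map) the residue field, and
`t : G → K` is a value group section (in particular `v` has value group `G`).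
The first two clauses say that `k` lies in the valuation ring and that every residue class
contains exactly one element of `k`. -/
structure HasSections (v : AddValuation K (WithTop G)) (t : G → K) : Prop where
  residue_nonneg : ∀ c : k, 0 ≤ v (algebraMap k K c)
  residue_section : ∀ x : K, 0 ≤ v x → ∃! c : k, 0 < v (x - algebraMap k K c)
  val_t : ∀ γ : G, v (t γ) = (γ : WithTop G)
  t_neg : ∀ γ : G, t (-γ) = (t γ)⁻¹

/-- `O[Λ] = {x ∈ K : v(x) > Λ}`, where `v(x) > Λ` means that `v(x)` is larger than every element
of `Λ^L`, i.e. `v(x) ∈ Λ^R` or `x = 0`. -/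
def idealOf (v : AddValuation K (WithTop G)) (Λ : Cut G) : Set K :=
  {x | ∀ γ ∈ Λ, (γ : WithTop G) < v x}

/-- A (`t`-compatible, multiplicative) tower of complements of the valuation ring for the valued
field `(K, v)` with residue field `k` and value group section `t`. -/
structure IsTower (v : AddValuation K (WithTop G)) (t : G → K) (A : Cut G → Set K) : Prop where
  /-- `A[Λ]` is a `k`-subspace. -/
  subspace : ∀ Λ, ∃ W : Submodule k K, (W : Set K) = A Λ
  /-- `A[Λ] ⊕ O[Λ] = K`. -/
  direct_sum : ∀ Λ, ∀ x : K, ∃! p : K × K, p.1 ∈ A Λ ∧ p.2 ∈ idealOf v Λ ∧ p.1 + p.2 = x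
  /-- `t^γ k ⊆ A[γ⁺]`. -/
  monomial_mem : ∀ (γ : G) (c : k), t γ * algebraMap k K c ∈ A (Cut.plus γ)
  /-- `Γ ≤ Λ` if and only if `A[Γ] ⊆ A[Λ]`. -/
  le_iff_subset : ∀ Γ Λ, Γ ≤ Λ ↔ A Γ ⊆ A Λ
  /-- `A[Λ] A[Γ] ⊆ A[Λ + Γ]`. -/
  mul_mem : ∀ Λ Γ, ∀ x ∈ A Λ, ∀ y ∈ A Γ, x * y ∈ A (Cut.leftSum Λ Γ)

end ValuedFields

section PseudoCauchy

variable {G : Type*} [AddCommGroup G] [LinearOrder G] [IsOrderedAddMonoid G]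
variable {K : Type*} [Field K] {F : Type*} [Field F] [Algebra K F]
variable {I : Type*} [LinearOrder I]

/-- `(a_ν)` is a pseudo Cauchy sequence: `v(a_σ - a_ρ) < v(a_τ - a_σ)` for `ρ < σ < τ`. -/
def IsPseudoCauchy (v : AddValuation K (WithTop G)) (s : I → K) : Prop :=
  ∀ ρ σ τ, ρ < σ → σ < τ → v (s σ - s ρ) < v (s τ - s σ)

/-- A pseudo Cauchy sequence `(a_ν)` in `K` is of transcendental type: for every polynomial
`p ∈ K[X]` the value `v(p(a_ν))` is eventually constant. -/
def IsTranscendentalType (v : AddValuation K (WithTop G)) (s : I → K) : Prop :=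
  ∀ p : Polynomial K, ∃ ν₀, ∀ ν, ν₀ ≤ ν → v (p.eval (s ν)) = v (p.eval (s ν₀))

/-- `a ∈ F` is a (pseudo-)limit of the pseudo Cauchy sequence `(a_ν)` in `K`:
`w(a - a_ρ) = w(a_σ - a_ρ)` for all `ρ < σ`. -/
def IsPseudoLimit (w : AddValuation F (WithTop G)) (s : I → K) (a : F) : Prop :=
  ∀ ρ σ, ρ < σ →
    w (a - algebraMap K F (s ρ)) = w (algebraMap K F (s σ) - algebraMap K F (s ρ))

/-- The cut `Λ_a = {w(a - c) : c ∈ K}⁺`. -/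
def approxCut (K : Type*) [Field K] [Algebra K F] (w : AddValuation F (WithTop G)) (a : F) :
    Cut G :=
  Cut.supPlus {γ : G | ∃ c : K, w (a - algebraMap K F c) = (γ : WithTop G)}

/-- The value `r(x)` of a rational function `r ∈ K(X)` (in lowest terms) at an element `x` of an
extension field; `0` if `x` is a pole of `r`. (Mathlib's `RatFunc.eval` needs both fields to live
in the same universe.) -/
noncomputable def evalRat (r : RatFunc K) (x : F) : F :=
  Polynomial.aeval x r.num / Polynomial.aeval x r.denom

/-- `C[Γ] = {r(a) : r ∈ K(X), r(a_ν) ∈ A[Γ] eventually}`. -/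
def extendedTower (A : Cut G → Set K) (s : I → K) (a : F) (Γ : Cut G) : Set F :=
  {x | ∃ r : RatFunc K, evalRat r a = x ∧
    ∃ ν₀, ∀ ν, ν₀ ≤ ν → evalRat r (s ν) ∈ A Γ}

end PseudoCauchy

end TowerComplements

namespace TowerComplements

set_option linter.unusedSectionVars false

/-! ### Truncation at cuts: the truncatable elements form a subfield -/

section Truncation

variable {G : Type*} [AddCommGroup G] [LinearOrder G] [IsOrderedAddMonoid G]
variable {F : Type*} [Field F]

theorem leftSum_le {Λ Γ Δ : Cut G} (h : ∀ l ∈ Λ, ∀ g ∈ Γ, l + g ∈ Δ) :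
    Cut.leftSum Λ Γ ≤ Δ := by
  rintro x ⟨_, ⟨l, hl, g, hg, rfl⟩, hx⟩
  exact Δ.lower hx (h l hl g hg)

theorem mem_plus {γ δ : G} : δ ∈ Cut.plus γ ↔ δ ≤ γ := LowerSet.mem_Iic_iff

/-- The largest cut `Λ` with `Λ + M ≤ Γ`. -/
def residual (Γ M : Cut G) : Cut G where
  carrier := {l | ∀ m ∈ M, l + m ∈ Γ}
  lower' := fun _ _ hba ha m hm => Γ.lower (add_le_add_left hba m) (ha m hm)

theorem mem_residual {Γ M : Cut G} {l : G} : l ∈ residual Γ M ↔ ∀ m ∈ M, l + m ∈ Γ := Iff.rfl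

theorem lt_coe_of_notMem {Λ : Cut G} {γ δ : G} (hδ : δ ∉ Λ) (hγ : γ ∈ Λ) : γ < δ :=
  lt_of_not_ge fun h => hδ (Λ.lower h hγ)

theorem mem_idealOf_of_le {w : AddValuation F (WithTop G)} {Λ : Cut G} {δ : G} {x : F}
    (hδ : δ ∉ Λ) (hx : (δ : WithTop G) ≤ w x) : x ∈ idealOf w Λ := fun _ hγ =>
  (WithTop.coe_lt_coe.2 (lt_coe_of_notMem hδ hγ)).trans_le hx

theorem idealOf_anti {w : AddValuation F (WithTop G)} {Λ Γ : Cut G} (h : Λ ≤ Γ) {x : F}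
    (hx : x ∈ idealOf w Γ) : x ∈ idealOf w Λ := fun γ hγ => hx γ (h hγ)

theorem zero_mem_idealOf (w : AddValuation F (WithTop G)) (Λ : Cut G) : (0 : F) ∈ idealOf w Λ :=
  fun γ _ => by simp

theorem add_mem_idealOf {w : AddValuation F (WithTop G)} {Λ : Cut G} {x y : F}
    (hx : x ∈ idealOf w Λ) (hy : y ∈ idealOf w Λ) : x + y ∈ idealOf w Λ :=
  fun γ hγ => w.map_lt_add (hx γ hγ) (hy γ hγ)

theorem neg_mem_idealOf {w : AddValuation F (WithTop G)} {Λ : Cut G} {x : F}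
    (hx : x ∈ idealOf w Λ) : -x ∈ idealOf w Λ := fun γ hγ => by
  rw [w.map_neg]; exact hx γ hγ

theorem sub_mem_idealOf {w : AddValuation F (WithTop G)} {Λ : Cut G} {x y : F}
    (hx : x ∈ idealOf w Λ) (hy : y ∈ idealOf w Λ) : x - y ∈ idealOf w Λ := by
  rw [sub_eq_add_neg]; exact add_mem_idealOf hx (neg_mem_idealOf hy)

theorem eq_zero_of_mem_idealOf_top {w : AddValuation F (WithTop G)} {x : F}
    (hx : x ∈ idealOf w ⊤) : x = 0 := by
  by_contra h
  obtain ⟨δ, hδ⟩ := WithTop.ne_top_iff_exists.1 (mt w.top_iff.1 h)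
  have := hx δ trivial
  rw [← hδ] at this
  exact lt_irrefl _ this

theorem exists_coe_val (w : AddValuation F (WithTop G)) {x : F} (h : x ≠ 0) :
    ∃ δ : G, w x = δ := by
  obtain ⟨δ, hδ⟩ := WithTop.ne_top_iff_exists.1 (mt w.top_iff.1 h)
  exact ⟨δ, hδ.symm⟩

theorem ne_zero_of_val {w : AddValuation F (WithTop G)} {x : F} {γ : G} (h : w x = γ) : x ≠ 0 := by
  rintro rfl
  rw [w.map_zero] at h
  exact WithTop.coe_ne_top h.symm

theorem val_inv {w : AddValuation F (WithTop G)} {x : F} {γ : G} (h : w x = γ) :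
    w x⁻¹ = ((-γ : G) : WithTop G) := by
  have h0 : x ≠ 0 := ne_zero_of_val h
  obtain ⟨δ, hδ⟩ := exists_coe_val w (inv_ne_zero h0)
  have := w.map_mul x x⁻¹
  rw [mul_inv_cancel₀ h0, w.map_one, h, hδ, ← WithTop.coe_add, ← WithTop.coe_zero,
    WithTop.coe_inj] at this
  rw [hδ, eq_neg_of_add_eq_zero_right this.symm]

/-- A multiplicative family of additive subgroups that is independent from the ideals `O[Λ]`. The
inverse axiom is automatic for a tower of complements. -/
structure IsPreTower (w : AddValuation F (WithTop G)) (C : Cut G → AddSubgroup F) : Prop where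
  mono : Monotone C
  eq_zero : ∀ {Λ x}, x ∈ C Λ → x ∈ idealOf w Λ → x = 0
  mul_mem : ∀ {Λ Γ x y}, x ∈ C Λ → y ∈ C Γ → x * y ∈ C (Cut.leftSum Λ Γ)
  exists_monomial : ∀ γ : G, ∃ τ ∈ C (Cut.plus γ), w τ = γ
  inv_mem : ∀ {Δ : Cut G} {x}, 0 ∈ Δ → Cut.leftSum Δ Δ ≤ Δ → x ∈ C Δ → w x = 0 → x⁻¹ ∈ C Δ

/-- `y` is the truncation of `x` at the cut `Λ`. -/
def IsTrunc (w : AddValuation F (WithTop G)) (C : Cut G → AddSubgroup F) (x : F) (Λ : Cut G)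
    (y : F) : Prop :=
  y ∈ C Λ ∧ x - y ∈ idealOf w Λ

/-- `x` has a truncation at every cut. -/
def Truncatable (w : AddValuation F (WithTop G)) (C : Cut G → AddSubgroup F) (x : F) : Prop :=
  ∀ Λ, ∃ y, IsTrunc w C x Λ y

variable {w : AddValuation F (WithTop G)} {C : Cut G → AddSubgroup F}

theorem IsTrunc.add {x x' y y' : F} {Λ : Cut G} (h : IsTrunc w C x Λ y)
    (h' : IsTrunc w C x' Λ y') : IsTrunc w C (x + x') Λ (y + y') :=
  ⟨add_mem h.1 h'.1, by rw [add_sub_add_comm]; exact add_mem_idealOf h.2 h'.2⟩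

theorem IsTrunc.neg {x y : F} {Λ : Cut G} (h : IsTrunc w C x Λ y) :
    IsTrunc w C (-x) Λ (-y) :=
  ⟨neg_mem h.1, by rw [neg_sub_neg, ← neg_sub]; exact neg_mem_idealOf h.2⟩

theorem isTrunc_self {x : F} {Λ : Cut G} (h : x ∈ C Λ) : IsTrunc w C x Λ x :=
  ⟨h, by rw [sub_self]; exact zero_mem_idealOf w Λ⟩

theorem isTrunc_zero {x : F} {Λ : Cut G} (h : x ∈ idealOf w Λ) : IsTrunc w C x Λ 0 :=
  ⟨zero_mem _, by rwa [sub_zero]⟩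

theorem Truncatable.add {x y : F} (hx : Truncatable w C x) (hy : Truncatable w C y) :
    Truncatable w C (x + y) := fun Λ =>
  let ⟨_, h⟩ := hx Λ
  let ⟨_, h'⟩ := hy Λ
  ⟨_, h.add h'⟩

theorem Truncatable.neg {x : F} (hx : Truncatable w C x) : Truncatable w C (-x) := fun Λ =>
  let ⟨_, h⟩ := hx Λ
  ⟨_, h.neg⟩

theorem Truncatable.sub {x y : F} (hx : Truncatable w C x) (hy : Truncatable w C y) :
    Truncatable w C (x - y) := by
  rw [sub_eq_add_neg]; exact hx.add hy.neg

theorem IsTrunc.eq_of_top {x y : F} (h : IsTrunc w C x ⊤ y) : x = y :=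
  sub_eq_zero.1 (eq_zero_of_mem_idealOf_top h.2)

theorem le_val_pow {x : F} {δ : G} (h : (δ : WithTop G) ≤ w x) (n : ℕ) :
    ((n • δ : G) : WithTop G) ≤ w (x ^ n) := by
  rw [w.map_pow, WithTop.coe_nsmul]
  exact nsmul_le_nsmul_right h n

theorem truncatable_sum {ι : Type*} (s : Finset ι) {f : ι → F} (hf : ∀ i, Truncatable w C (f i)) :
    Truncatable w C (∑ i ∈ s, f i) := by
  classical
  induction s using Finset.induction_on with
  | empty => exact fun Γ => ⟨0, isTrunc_zero (zero_mem_idealOf w Γ)⟩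
  | insert i s hi ih => rw [Finset.sum_insert hi]; exact (hf i).add ih

theorem le_val_of_mem_idealOf_Iio {x : F} {m : G} (h : x ∈ idealOf w (LowerSet.Iio m)) :
    (m : WithTop G) ≤ w x := by
  by_contra hlt
  push Not at hlt
  obtain ⟨δ, hδ⟩ := WithTop.ne_top_iff_exists.1 hlt.ne_top
  rw [← hδ] at hlt
  have := h δ (LowerSet.mem_Iio_iff.2 (WithTop.coe_lt_coe.1 hlt))
  rw [← hδ] at this
  exact lt_irrefl _ this

namespace IsPreTower

variable (hC : IsPreTower w C)
include hC

theorem trunc_unique {x y z : F} {Λ : Cut G} (hy : IsTrunc w C x Λ y) (hz : IsTrunc w C x Λ z) :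
    y = z := by
  refine sub_eq_zero.1 (hC.eq_zero (sub_mem hy.1 hz.1) ?_)
  have := sub_mem_idealOf hz.2 hy.2
  rwa [sub_sub_sub_cancel_left] at this

/-- Below Λ the truncations of x serve for y as well; from Λ on, y is its own truncation. -/
theorem trunc_truncatable {x y : F} {Λ : Cut G} (hx : Truncatable w C x)
    (hy : IsTrunc w C x Λ y) : Truncatable w C y := fun Γ => by
  rcases le_total Λ Γ with h | h
  · exact ⟨y, isTrunc_self (hC.mono h hy.1)⟩
  · obtain ⟨z, hz⟩ := hx Γ
    refine ⟨z, hz.1, ?_⟩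
    have := sub_mem_idealOf hz.2 (idealOf_anti h hy.2)
    rwa [sub_sub_sub_cancel_left] at this

/-- Among the cuts at which the truncation of `x` satisfies `P` there is a smallest one. -/
theorem exists_minimal_trunc {x : F} (hx : Truncatable w C x) (P : F → Prop)
    (h : ∃ M y, IsTrunc w C x M y ∧ P y) :
    ∃ M y, IsTrunc w C x M y ∧ P y ∧ ∀ M' < M, ∀ y', IsTrunc w C x M' y' → ¬ P y' := by
  let S : Set (Cut G) := {M | ∃ y, IsTrunc w C x M y ∧ P y}
  obtain ⟨y, hy⟩ := hx (sInf S)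
  -- The infimum is attained: the value of x - y lies outside some M ∈ S, so y is already the
  -- truncation of x at M and inherits P.
  obtain ⟨M, hMS, hM⟩ : ∃ M ∈ S, x - y ∈ idealOf w M := by
    by_cases h0 : x - y = 0
    · obtain ⟨M, hM⟩ := h
      exact ⟨M, hM, by rw [h0]; exact zero_mem_idealOf w M⟩
    · obtain ⟨δ, hδ⟩ := exists_coe_val w h0
      have hn : δ ∉ sInf S := fun hmem => by
        have := hy.2 δ hmem
        rw [hδ] at this
        exact lt_irrefl _ this
      rw [LowerSet.mem_sInf_iff] at hn
      push Not at hn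
      obtain ⟨M, hM, hδM⟩ := hn
      exact ⟨M, hM, mem_idealOf_of_le hδM hδ.ge⟩
  obtain ⟨z, hz, hPz⟩ := hMS
  have hyz : y = z := hC.trunc_unique ⟨hC.mono (sInf_le (show M ∈ S from ⟨z, hz, hPz⟩)) hy.1, hM⟩ hz
  exact ⟨sInf S, y, hy, hyz ▸ hPz, fun M' hM' y' hy' hP =>
    (sInf_le (show M' ∈ S from ⟨y', hy', hP⟩)).not_gt hM'⟩

/-- Minimal counterexample over the truncations u of y. Subtracting from z its truncation at the
largest cut whose sum with M stays below Γ costs only an element of C[Γ]; what is left of z is so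
small that only a shorter truncation of u matters. -/
theorem truncatable_mul {x y : F} (hx : Truncatable w C x) (hy : Truncatable w C y) :
    Truncatable w C (x * y) := by
  intro Γ
  by_contra hbad
  obtain ⟨y₀, hy₀⟩ := hy ⊤
  -- The other factor is quantified inside the property, so that minimality can be applied to z -
  -- z₀. The start is the cut ⊤, where y is its own truncation.
  obtain ⟨M, u, hu, ⟨z, hz, hzu⟩, hmin⟩ := hC.exists_minimal_trunc hy
    (fun u => ∃ z, Truncatable w C z ∧ ¬ ∃ r, IsTrunc w C (z * u) Γ r)
    ⟨⊤, y₀, hy₀, x, hx, by rwa [← hy₀.eq_of_top]⟩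
  apply hzu
  obtain ⟨z₀, hz₀⟩ := hz (residual Γ M)
  have h1 : z₀ * u ∈ C Γ := hC.mono (leftSum_le fun l hl => mem_residual.1 hl)
    (hC.mul_mem hz₀.1 hu.1)
  suffices h : ∃ r, IsTrunc w C ((z - z₀) * u) Γ r by
    obtain ⟨r, hr⟩ := h
    refine ⟨z₀ * u + r, ?_⟩
    convert (isTrunc_self h1).add hr using 1
    ring
  by_cases h0 : z - z₀ = 0
  · exact ⟨0, by rw [h0, zero_mul]; exact isTrunc_zero (zero_mem_idealOf w Γ)⟩
  obtain ⟨δ, hδ⟩ := exists_coe_val w h0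
  have hδM : δ ∉ residual Γ M := fun hmem => by
    have := hz₀.2 δ hmem
    rw [hδ] at this
    exact lt_irrefl _ this
  rw [mem_residual] at hδM
  push Not at hδM
  obtain ⟨m, hm, hmΓ⟩ := hδM
  -- N is chosen so that an element of value δ times O[N] lies in O[Γ]; the element m shows that N
  -- is strictly below M.
  let N : Cut G := residual Γ (Cut.plus δ)
  have hmN : m ∉ N := fun h => hmΓ (by rw [add_comm]; exact h δ (mem_plus.2 le_rfl))
  have hNM : N < M := lt_of_not_ge fun h => hmN (h hm)
  obtain ⟨u₁, hu₁⟩ := hy N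
  have hgood := hmin N hNM u₁ hu₁
  push Not at hgood
  obtain ⟨r, hr⟩ := hgood (z - z₀) (hz.sub (hC.trunc_truncatable hz hz₀))
  have h2 : (z - z₀) * (u - u₁) ∈ idealOf w Γ := by
    have hd : u - u₁ ∈ idealOf w N := by
      have := sub_mem_idealOf hu₁.2 (idealOf_anti hNM.le hu.2)
      rwa [sub_sub_sub_cancel_left] at this
    by_cases h3 : u - u₁ = 0
    · rw [h3, mul_zero]; exact zero_mem_idealOf w Γ
    obtain ⟨ε, hε⟩ := exists_coe_val w h3
    have hεN : ε ∉ N := fun hmem => by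
      have := hd ε hmem
      rw [hε] at this
      exact lt_irrefl _ this
    refine mem_idealOf_of_le (δ := δ + ε) (fun h => hεN fun m hm => ?_) ?_
    · rw [add_comm]
      exact Γ.lower (add_le_add_left (mem_plus.1 hm) ε) h
    · rw [w.map_mul, hδ, hε, WithTop.coe_add]
  refine ⟨r, ?_⟩
  convert hr.add (isTrunc_zero h2) using 1 <;> ring

theorem one_mem_zero_plus : (1 : F) ∈ C (Cut.plus 0) := by
  obtain ⟨τ, hτ, hτ0⟩ := hC.exists_monomial 0
  have hle : Cut.leftSum (Cut.plus (0 : G)) (Cut.plus 0) ≤ Cut.plus 0 :=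
    leftSum_le fun l hl m hm => mem_plus.2 (add_nonpos (mem_plus.1 hl) (mem_plus.1 hm))
  have h0 : τ ≠ 0 := ne_zero_of_val hτ0
  have := hC.mul_mem hτ (hC.inv_mem (mem_plus.2 le_rfl) hle hτ hτ0)
  rw [mul_inv_cancel₀ h0] at this
  exact hC.mono hle this

theorem truncatable_one : Truncatable w C 1 := fun Γ => by
  by_cases h : (0 : G) ∈ Γ
  · refine ⟨1, isTrunc_self (hC.mono ?_ hC.one_mem_zero_plus)⟩
    exact fun x hx => Γ.lower (mem_plus.1 hx) h
  · exact ⟨0, isTrunc_zero (mem_idealOf_of_le h (by rw [w.map_one, WithTop.coe_zero]))⟩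

theorem truncatable_pow {x : F} (hx : Truncatable w C x) (n : ℕ) : Truncatable w C (x ^ n) := by
  induction n with
  | zero => rw [pow_zero]; exact hC.truncatable_one
  | succ n ih => rw [pow_succ]; exact hC.truncatable_mul ih hx

/-- If the proper truncations of `y` have truncatable inverses, then either `y⁻¹` has a truncation
at `Γ` or `Γ` contains all multiples of the shifted exponents of `y`. -/
theorem exists_trunc_inv_or {y : F} {γ : G} (hγ : w y = γ) {M Γ : Cut G}
    (hy : Truncatable w C y)
    (hinv : ∀ N < M, ∀ u, IsTrunc w C y N u → u ≠ 0 → Truncatable w C u⁻¹) :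
    (∃ r, IsTrunc w C y⁻¹ Γ r) ∨ ∀ m ∈ M, ∀ n : ℕ, n • (m - γ) - γ ∈ Γ := by
  by_contra hcon
  push Not at hcon
  obtain ⟨hno, m, hm, n, hn⟩ := hcon
  have hy0 : y ≠ 0 := ne_zero_of_val hγ
  -- If -γ ∉ Γ, then y⁻¹ ∈ O[Γ] has truncation 0. Once -γ ∈ Γ, no m ≤ γ can give n(m - γ) - γ ∉ Γ,
  -- so m > γ.
  have hγΓ : -γ ∈ Γ := by
    by_contra h
    exact hno 0 (isTrunc_zero (mem_idealOf_of_le h (val_inv hγ).ge))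
  rcases le_or_gt m γ with hmγ | hmγ
  · refine hn (Γ.lower ?_ hγΓ)
    have := nsmul_nonpos (sub_nonpos.2 hmγ) n
    simpa [sub_eq_add_neg] using this
  have hN : LowerSet.Iio m < M := lt_of_not_ge fun h => lt_irrefl m (LowerSet.mem_Iio_iff.1 (h hm))
  -- Since w(y - u) ≥ m > γ, we have y = u(1 - q) with w(q) ≥ m - γ, and the geometric series gives
  -- y⁻¹ = u⁻¹ ∑_{i<n} q^i + y⁻¹ q^n. The remainder has value at least n(m - γ) - γ, which is
  -- outside Γ.
  obtain ⟨u, hu⟩ := hy (LowerSet.Iio m)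
  have he := le_val_of_mem_idealOf_Iio hu.2
  have hwu : w u = γ := by
    have h1 : w y < w (u - y) := by
      rw [w.map_sub_swap, hγ]
      exact (WithTop.coe_lt_coe.2 hmγ).trans_le he
    have := w.map_add_eq_of_lt_right h1
    rw [← hγ, ← this]
    congr 1
    ring
  have hu0 : u ≠ 0 := ne_zero_of_val hwu
  have hui := hinv _ hN u hu hu0
  set q : F := (u - y) * u⁻¹ with hq
  have hqR : Truncatable w C q :=
    hC.truncatable_mul ((hC.trunc_truncatable hy hu).sub hy) hui
  have hqv : ((m - γ : G) : WithTop G) ≤ w q := by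
    rw [hq, w.map_mul, w.map_sub_swap, val_inv hwu, sub_eq_add_neg, WithTop.coe_add]
    gcongr
  have hS : Truncatable w C (u⁻¹ * ∑ i ∈ Finset.range n, q ^ i) :=
    hC.truncatable_mul hui (truncatable_sum _ (hC.truncatable_pow hqR))
  obtain ⟨r, hr⟩ := hS Γ
  have hrest : y⁻¹ * q ^ n ∈ idealOf w Γ := by
    refine mem_idealOf_of_le hn ?_
    rw [w.map_mul, val_inv hγ, sub_eq_add_neg, add_comm, WithTop.coe_add]
    gcongr
    exact le_val_pow hqv n
  refine hno r ?_
  have hgeom : (∑ i ∈ Finset.range n, q ^ i) * (q - 1) = q ^ n - 1 := geom_sum_mul q n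
  have hq1 : q - 1 = - (y * u⁻¹) := by rw [hq]; field_simp; ring
  have : u⁻¹ * ∑ i ∈ Finset.range n, q ^ i + y⁻¹ * q ^ n = y⁻¹ := by
    have hqn : q ^ n = 1 - (∑ i ∈ Finset.range n, q ^ i) * (y * u⁻¹) := by
      rw [hq1] at hgeom
      linear_combination -hgeom
    rw [hqn]
    field_simp
    ring
  have h := hr.add (isTrunc_zero (C := C) hrest)
  rwa [this, add_zero] at h

/-- Normalise y to value 0 with a monomial τ of value -γ. Then yτ lies in the complement at an
additively closed cut Δ, where inverses of elements of value 0 stay; multiplying back by τ lands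
below Γ by hypothesis. -/
theorem inv_mem_of_nsmul_mem {y : F} {γ : G} (hγ : w y = γ) {M Γ : Cut G} (hy : y ∈ C M)
    (h : ∀ m ∈ M, ∀ n : ℕ, n • (m - γ) - γ ∈ Γ) : y⁻¹ ∈ C Γ := by
  have hy0 : y ≠ 0 := ne_zero_of_val hγ
  have hγM : γ ∈ M := by
    by_contra hn
    exact hy0 (hC.eq_zero hy (mem_idealOf_of_le hn hγ.ge))
  let Δ : Cut G := lowerClosure {d | ∃ n : ℕ, ∃ m ∈ M, d = n • (m - γ)}
  have hΔ : ∀ (n : ℕ) m, m ∈ M → n • (m - γ) ∈ Δ := fun n m hm =>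
    subset_lowerClosure ⟨n, m, hm, rfl⟩
  have hΔ0 : (0 : G) ∈ Δ := by simpa using hΔ 0 γ hγM
  have hΔΔ : Cut.leftSum Δ Δ ≤ Δ := by
    refine leftSum_le ?_
    rintro d ⟨_, ⟨n, m, hm, rfl⟩, hd⟩ d' ⟨_, ⟨n', m', hm', rfl⟩, hd'⟩
    -- A common m bounds both summands, which makes Δ additively closed.
    have hmax : max m m' ∈ M := by rcases max_choice m m' with h | h <;> rwa [h]
    refine Δ.lower ?_ (hΔ (n + n') _ hmax)
    rw [add_nsmul]
    exact add_le_add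
      (hd.trans (nsmul_le_nsmul_right (sub_le_sub_right (le_max_left _ _) _) n))
      (hd'.trans (nsmul_le_nsmul_right (sub_le_sub_right (le_max_right _ _) _) n'))
  obtain ⟨τ, hτ, hwτ⟩ := hC.exists_monomial (-γ)
  have hτ0 : τ ≠ 0 := ne_zero_of_val hwτ
  have h1 : y * τ ∈ C Δ := by
    refine hC.mono (leftSum_le fun m hm l hl => ?_) (hC.mul_mem hy hτ)
    refine Δ.lower ?_ (hΔ 1 m hm)
    rw [one_nsmul, sub_eq_add_neg]
    exact add_le_add_right (mem_plus.1 hl) m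
  have h2 : w (y * τ) = 0 := by
    rw [w.map_mul, hγ, hwτ, ← WithTop.coe_add, add_neg_cancel, WithTop.coe_zero]
  have h3 := hC.mul_mem (hC.inv_mem hΔ0 hΔΔ h1 h2) hτ
  have h4 : (y * τ)⁻¹ * τ = y⁻¹ := by field_simp
  rw [h4] at h3
  refine hC.mono (leftSum_le ?_) h3
  rintro d ⟨_, ⟨n, m, hm, rfl⟩, hd⟩ l hl
  refine Γ.lower ?_ (h m hm n)
  rw [sub_eq_add_neg]
  exact add_le_add hd (mem_plus.1 hl)

/-- Take the shortest nonzero truncation y of x without truncatable inverse. At each Γ, either the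
geometric series around a shorter truncation yields a truncation of y⁻¹, or y⁻¹ itself lies in C[Γ].
-/
theorem truncatable_inv {x : F} (hx : Truncatable w C x) : Truncatable w C x⁻¹ := by
  by_cases hx0 : x = 0
  · rwa [hx0, inv_zero, ← hx0]
  by_contra hbad
  obtain ⟨x₀, hx₀⟩ := hx ⊤
  obtain ⟨M, y, hy, ⟨hy0, hyi⟩, hmin⟩ := hC.exists_minimal_trunc hx
    (fun u => u ≠ 0 ∧ ¬ Truncatable w C u⁻¹)
    ⟨⊤, x₀, hx₀, by rw [← hx₀.eq_of_top]; exact ⟨hx0, hbad⟩⟩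
  obtain ⟨γ, hγ⟩ := exists_coe_val w hy0
  refine hyi fun Γ => ?_
  refine (hC.exists_trunc_inv_or (M := M) hγ (hC.trunc_truncatable hx hy) ?_).elim id fun h =>
    ⟨_, isTrunc_self (hC.inv_mem_of_nsmul_mem hγ hy.1 h)⟩
  intro N hN u hu hu0
  by_contra hui
  refine hmin N hN u ⟨hu.1, ?_⟩ ⟨hu0, hui⟩
  have := add_mem_idealOf (idealOf_anti hN.le hy.2) hu.2
  rwa [sub_add_sub_cancel] at this

/-- The elements that can be truncated at every cut form a subfield. -/
def truncatableSubfield : Subfield F where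
  carrier := {x | Truncatable w C x}
  mul_mem' := hC.truncatable_mul
  one_mem' := hC.truncatable_one
  add_mem' := Truncatable.add
  zero_mem' := fun Γ => ⟨0, isTrunc_zero (zero_mem_idealOf w Γ)⟩
  neg_mem' := Truncatable.neg
  inv_mem' := fun _ => hC.truncatable_inv

end IsPreTower

end Truncation

/-! ### Kaplansky's lemma: values of polynomials near a pseudo-limit -/

section Approximation

open Polynomial Filter

variable {G : Type*} [AddCommGroup G] [LinearOrder G] [IsOrderedAddMonoid G]
variable {K F : Type*} [Field K] [Field F] [Algebra K F]

/-- `x` has a distance from `a` lying in the cut `Λ` beyond `γ`. -/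
def IsNear (w : AddValuation F (WithTop G)) (a : F) (Λ : Cut G) (γ : G) (x : F) : Prop :=
  ∃ δ ∈ Λ, γ ≤ δ ∧ w (x - a) = δ

theorem IsNear.of_le {w : AddValuation F (WithTop G)} {a : F} {Λ : Cut G} {γ γ' : G} {x : F}
    (h : IsNear w a Λ γ x) (hγ : γ' ≤ γ) : IsNear w a Λ γ' x :=
  let ⟨δ, h1, h2, h3⟩ := h
  ⟨δ, h1, hγ.trans h2, h3⟩

/-- Near `a`, a polynomial `g` either has the leading term `g(a)` or a value that increases strictly
with the distance to `a`. -/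
theorem val_eval_dichotomy (w : AddValuation F (WithTop G)) (a : F) (Λ : Cut G)
    (hne : ∃ γ, γ ∈ Λ) (hmax : ∀ x γ, IsNear w a Λ γ x → ∃ y, IsNear w a Λ γ y ∧
      w (x - a) < w (y - a))
    (n : ℕ) : ∀ g : F[X], g.natDegree = n → g ≠ 0 → ∃ γ ∈ Λ,
      (∀ x, IsNear w a Λ γ x → w (g.eval a) < w (g.eval x - g.eval a)) ∨
      (∀ x y, IsNear w a Λ γ x → IsNear w a Λ γ y →
        (w (x - a) ≤ w (y - a) → w (g.eval x) ≤ w (g.eval y)) ∧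
        (w (x - a) < w (y - a) → w (g.eval x) < w (g.eval y)) ∧ w (g.eval x) ≠ ⊤) := by
  induction n with
  | zero =>
    intro g hg hg0
    obtain ⟨γ, hγ⟩ := hne
    refine ⟨γ, hγ, Or.inl fun x _ => ?_⟩
    obtain ⟨c, rfl⟩ := natDegree_eq_zero.1 hg
    have hc : c ≠ 0 := by rintro rfl; simp at hg0
    rw [eval_C, eval_C, sub_self, w.map_zero]
    exact lt_top_iff_ne_top.2 (mt w.top_iff.1 hc)
  | succ n ih =>
    intro g hg _
    -- g(x) = g(a) + (x - a)h(x). By induction w(h(x)) is constant or increasing near a, so the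
    -- second summand has strictly increasing value.
    set h := g /ₘ (X - C a) with hh
    have hdeg : h.natDegree = n := by
      rw [hh, natDegree_divByMonic _ (monic_X_sub_C a), natDegree_X_sub_C, hg]; rfl
    have hgh : ∀ x, g.eval x = g.eval a + (x - a) * h.eval x := fun x => by
      have := congrArg (eval x) (modByMonic_add_div g (X - C a))
      rw [modByMonic_X_sub_C_eq_C_eval] at this
      simpa using this.symm
    have hh0 : h ≠ 0 := by
      intro h0
      have : g = C (g.eval a) := by
        rw [← modByMonic_X_sub_C_eq_C_eval]
        have := modByMonic_add_div g (X - C a)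
        rw [← hh, h0, mul_zero, add_zero] at this
        exact this.symm
      rw [this, natDegree_C] at hg
      omega
    obtain ⟨γ, hγ, hmono⟩ : ∃ γ ∈ Λ, ∀ x y, IsNear w a Λ γ x → IsNear w a Λ γ y →
        w (x - a) ≤ w (y - a) → w (h.eval x) ≤ w (h.eval y) ∧ w (h.eval x) ≠ ⊤ := by
      obtain ⟨γ, hγ, h1 | h1⟩ := ih h hdeg hh0
      · refine ⟨γ, hγ, fun x y hx hy _ => ?_⟩
        have e : ∀ z, IsNear w a Λ γ z → w (h.eval z) = w (h.eval a) := fun z hz => by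
          have := w.map_add_eq_of_lt_right (h1 z hz)
          rwa [sub_add_cancel] at this
        rw [e x hx, e y hy]
        exact ⟨le_rfl, (h1 x hx).ne_top⟩
      · exact ⟨γ, hγ, fun x y hx hy hxy => ⟨(h1 x y hx hy).1 hxy, (h1 x y hx hy).2.2⟩⟩
    have hle : ∀ x y, IsNear w a Λ γ x → IsNear w a Λ γ y → w (x - a) ≤ w (y - a) →
        w ((x - a) * h.eval x) ≤ w ((y - a) * h.eval y) := fun x y hx hy hxy => by
      rw [w.map_mul, w.map_mul]
      exact add_le_add hxy (hmono x y hx hy hxy).1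
    have hlt : ∀ x y, IsNear w a Λ γ x → IsNear w a Λ γ y → w (x - a) < w (y - a) →
        w ((x - a) * h.eval x) < w ((y - a) * h.eval y) := fun x y hx hy hxy => by
      rw [w.map_mul, w.map_mul]
      obtain ⟨h1, h2⟩ := hmono x y hx hy hxy.le
      exact (WithTop.add_lt_add_right h2 hxy).trans_le (add_le_add le_rfl h1)
    -- Either the summand (x - a)h(x) overtakes g(a) in value at some x₀, and then at everything at
    -- least as near, or it never does and determines the value of g(x).
    by_cases hcase : ∃ x₀, IsNear w a Λ γ x₀ ∧ w (g.eval a) < w ((x₀ - a) * h.eval x₀)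
    · obtain ⟨x₀, ⟨δ, hδ, hγδ, hx₀⟩, hlt₀⟩ := hcase
      refine ⟨δ, hδ, Or.inl fun x hx => ?_⟩
      rw [hgh x, add_sub_cancel_left]
      refine hlt₀.trans_le (hle x₀ x ⟨δ, hδ, hγδ, hx₀⟩ (hx.of_le hγδ) ?_)
      obtain ⟨ε, _, hδε, hε⟩ := hx
      rw [hx₀, hε]
      exact WithTop.coe_le_coe.2 hδε
    · push Not at hcase
      -- The inequality is strict because there is always a point still nearer to a.
      have key : ∀ x, IsNear w a Λ γ x → w ((x - a) * h.eval x) < w (g.eval a) := fun x hx =>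
        let ⟨y, hy, hxy⟩ := hmax x γ hx
        (hlt x y hx hy hxy).trans_le (hcase y hy)
      have hval : ∀ x, IsNear w a Λ γ x → w (g.eval x) = w ((x - a) * h.eval x) := fun x hx => by
        rw [hgh x]; exact w.map_add_eq_of_lt_right (key x hx)
      refine ⟨γ, hγ, Or.inr fun x y hx hy => ?_⟩
      rw [hval x hx, hval y hy]
      exact ⟨hle x y hx hy, hlt x y hx hy, (key x hx).ne_top⟩

variable {I : Type*} [LinearOrder I]

/-- Nonzero polynomials do not vanish at `a`, and their values on `s` eventually have the same leading
term as their value at `a`. -/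
def Approximates (w : AddValuation F (WithTop G)) (s : I → K) (a : F) : Prop :=
  ∀ p : K[X], p ≠ 0 → aeval a p ≠ 0 ∧
    ∀ᶠ ν in atTop, 0 < w (algebraMap K F (p.eval (s ν)) / aeval a p - 1)

theorem eval_map_algebraMap_eq (p : K[X]) (x : K) :
    (p.map (algebraMap K F)).eval (algebraMap K F x) = algebraMap K F (p.eval x) := by
  rw [eval_map_algebraMap, aeval_algebraMap_apply_eq_algebraMap_eval]

theorem val_sub_lt_of_isPseudoLimit [NoMaxOrder I] {v : AddValuation K (WithTop G)}
    {w : AddValuation F (WithTop G)} (hw : ∀ x : K, w (algebraMap K F x) = v x) {s : I → K} {a : F}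
    (hs : IsPseudoCauchy v s) (ha : IsPseudoLimit w s a) {ρ σ : I} (h : ρ < σ) :
    w (algebraMap K F (s ρ) - a) < w (algebraMap K F (s σ) - a) := by
  obtain ⟨τ, hτ⟩ := exists_gt σ
  rw [w.map_sub_swap, w.map_sub_swap _ a, ha ρ σ h, ha σ τ hτ, ← map_sub, ← map_sub, hw, hw]
  exact hs ρ σ τ h hτ

theorem mem_approxCut {w : AddValuation F (WithTop G)} {a : F} {γ : G} :
    γ ∈ approxCut K w a ↔ ∃ c : K, (γ : WithTop G) ≤ w (algebraMap K F c - a) ∧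
      w (algebraMap K F c - a) ≠ ⊤ := by
  constructor
  · rintro ⟨δ, ⟨c, hc⟩, hγ⟩
    refine ⟨c, ?_⟩
    rw [w.map_sub_swap, hc]
    exact ⟨WithTop.coe_le_coe.2 hγ, WithTop.coe_ne_top⟩
  · rintro ⟨c, hc, hc'⟩
    obtain ⟨δ, hδ⟩ := WithTop.ne_top_iff_exists.1 hc'
    rw [← hδ] at hc
    exact ⟨δ, ⟨c, by rw [w.map_sub_swap, hδ]⟩, WithTop.coe_le_coe.1 hc⟩

section Sequence

variable [Nonempty I] [NoMaxOrder I] {v : AddValuation K (WithTop G)}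
  {w : AddValuation F (WithTop G)} {a : F} {s s' : I → K}

/-- If all a_ν stayed farther from a than some c ∈ K, then v(a_ν - c) = w(a_ν - a) would increase
strictly, contradicting transcendental type for the polynomial X - c. -/
theorem eventually_isNear (hw : ∀ x : K, w (algebraMap K F x) = v x) (hs : IsPseudoCauchy v s)
    (htr : IsTranscendentalType v s) (ha : IsPseudoLimit w s a) {γ : G}
    (hγ : γ ∈ approxCut K w a) :
    ∀ᶠ ν in atTop, IsNear w a (approxCut K w a) γ (algebraMap K F (s ν)) := by
  have hlt := fun {ρ σ : I} => val_sub_lt_of_isPseudoLimit hw hs ha (ρ := ρ) (σ := σ)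
  obtain ⟨ν, hν⟩ : ∃ ν, (γ : WithTop G) ≤ w (algebraMap K F (s ν) - a) := by
    by_contra! hcon
    obtain ⟨c, hc, -⟩ := mem_approxCut.1 hγ
    have hval : ∀ ν, v ((X - C c).eval (s ν)) = w (algebraMap K F (s ν) - a) := fun ν => by
      have h1 : w (algebraMap K F (s ν) - a) < w (a - algebraMap K F c) := by
        rw [w.map_sub_swap a]
        exact (hcon ν).trans_le hc
      rw [← hw, ← w.map_add_eq_of_lt_left h1, eval_sub, eval_X, eval_C, map_sub, sub_add_sub_cancel]
    obtain ⟨ν₀, h0⟩ := htr (X - C c)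
    obtain ⟨ν₁, h1⟩ := exists_gt ν₀
    have := h0 ν₁ h1.le
    rw [hval, hval] at this
    exact (hlt h1).ne' this
  filter_upwards [eventually_ge_atTop ν] with μ hμ
  obtain ⟨τ, hτ⟩ := exists_gt μ
  have h1 := (hlt hτ).ne_top
  obtain ⟨δ, hδ⟩ := WithTop.ne_top_iff_exists.1 h1
  refine ⟨δ, mem_approxCut.2 ⟨_, hδ.le, h1⟩, ?_, hδ.symm⟩
  rw [← WithTop.coe_le_coe, hδ]
  rcases hμ.eq_or_lt with rfl | h
  · exact hν
  · exact hν.trans (hlt h).le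

/-- The distance w(a_ν - a) lies in Λ_a, whereas a_ν - a'_ν has value beyond Λ_a. -/
theorem val_sub_eq_of_sub_mem (hw : ∀ x : K, w (algebraMap K F x) = v x)
    (hs : IsPseudoCauchy v s) (ha : IsPseudoLimit w s a)
    (hss' : ∀ ν, s ν - s' ν ∈ idealOf v (approxCut K w a)) (ν : I) :
    w (algebraMap K F (s' ν) - a) = w (algebraMap K F (s ν) - a) := by
  obtain ⟨τ, hτ⟩ := exists_gt ν
  have h1 := (val_sub_lt_of_isPseudoLimit hw hs ha hτ).ne_top
  obtain ⟨δ, hδ⟩ := WithTop.ne_top_iff_exists.1 h1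
  have h2 := hss' ν δ (mem_approxCut.2 ⟨_, hδ.le, h1⟩)
  rw [← v.map_neg, ← hw, hδ] at h2
  rw [← w.map_add_eq_of_lt_left h2]
  congr 1
  rw [map_neg, map_sub]
  ring

/-- Kaplansky's lemma for sequences of transcendental type. -/
theorem approximates_of_sub_mem (hw : ∀ x : K, w (algebraMap K F x) = v x)
    (hs : IsPseudoCauchy v s) (htr : IsTranscendentalType v s) (ha : IsPseudoLimit w s a)
    (hss' : ∀ ν, s ν - s' ν ∈ idealOf v (approxCut K w a)) : Approximates w s' a := by
  intro p hp
  have hlt := fun {ρ σ : I} => val_sub_lt_of_isPseudoLimit hw hs ha (ρ := ρ) (σ := σ)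
  have hnear := fun {γ : G} => eventually_isNear hw hs htr ha (γ := γ)
  let g := p.map (algebraMap K F)
  have hga : g.eval a = aeval a p := eval_map_algebraMap p a
  have hg0 : g ≠ 0 := (Polynomial.map_ne_zero_iff (algebraMap K F).injective).2 hp
  have hne : ∃ γ, γ ∈ approxCut K w a := by
    obtain ⟨ν⟩ := ‹Nonempty I›
    obtain ⟨τ, hτ⟩ := exists_gt ν
    have h1 := (hlt hτ).ne_top
    obtain ⟨δ, hδ⟩ := WithTop.ne_top_iff_exists.1 h1
    exact ⟨δ, mem_approxCut.2 ⟨_, hδ.le, h1⟩⟩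
  have hmax : ∀ x γ, IsNear w a (approxCut K w a) γ x → ∃ y, IsNear w a (approxCut K w a) γ y ∧
      w (x - a) < w (y - a) := by
    rintro x γ ⟨δ, hδ, hγδ, hx⟩
    obtain ⟨ν, hν⟩ := eventually_atTop.1 (hnear hδ)
    obtain ⟨τ, hτ⟩ := exists_gt ν
    refine ⟨_, (hν τ hτ.le).of_le hγδ, lt_of_le_of_lt ?_ (hlt hτ)⟩
    obtain ⟨ε, _, hδε, hε⟩ := hν ν le_rfl
    rw [hx, hε]
    exact WithTop.coe_le_coe.2 hδε
  obtain ⟨γ, hγ, h | h⟩ := val_eval_dichotomy w a _ hne hmax _ g rfl hg0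
  · obtain ⟨ν₀, hν₀⟩ := eventually_atTop.1 (hnear hγ)
    have hpa : aeval a p ≠ 0 := by
      have := (h _ (hν₀ ν₀ le_rfl)).ne_top
      rw [hga] at this
      exact mt w.top_iff.2 this
    refine ⟨hpa, ?_⟩
    filter_upwards [hnear hγ] with ν hν
    have hν' : IsNear w a (approxCut K w a) γ (algebraMap K F (s' ν)) := by
      obtain ⟨δ, h1, h2, h3⟩ := hν
      exact ⟨δ, h1, h2, by rw [val_sub_eq_of_sub_mem hw hs ha hss', h3]⟩
    have := h _ hν'
    rw [eval_map_algebraMap_eq, hga] at this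
    obtain ⟨δ, hδ⟩ := exists_coe_val w hpa
    rw [div_sub_one hpa, div_eq_mul_inv, w.map_mul, val_inv hδ]
    rw [hδ] at this
    have h2 := WithTop.add_lt_add_right (z := ((-δ : G) : WithTop G)) WithTop.coe_ne_top this
    rwa [← WithTop.coe_add, add_neg_cancel, WithTop.coe_zero] at h2
  -- Here the values of p would increase strictly along the original sequence s, contradicting
  -- transcendental type.
  · exfalso
    obtain ⟨ν₀, h0⟩ := htr p
    obtain ⟨ν₁, h1⟩ := eventually_atTop.1 (hnear hγ)
    obtain ⟨τ, hτ⟩ := exists_gt (max ν₀ ν₁)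
    have h2 := (h _ _ (h1 _ (le_max_right ν₀ ν₁)) (h1 τ ((le_max_right _ _).trans hτ.le))).2.1
      (hlt hτ)
    rw [eval_map_algebraMap_eq, eval_map_algebraMap_eq, hw, hw, h0 _ (le_max_left _ _),
      h0 τ ((le_max_left _ _).trans hτ.le)] at h2
    exact lt_irrefl _ h2

end Sequence

end Approximation

/-! ### Elements of K(a) as germs of sequences in K -/

section Extension

open Polynomial Filter

variable {G : Type*} [AddCommGroup G] [LinearOrder G] [IsOrderedAddMonoid G]
variable {K F : Type*} [Field K] [Field F] [Algebra K F]

theorem val_lt_sub {w : AddValuation F (WithTop G)} {x y : F} {g : WithTop G} (hx : g < w x)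
    (hy : g < w y) : g < w (x - y) := by
  rw [sub_eq_add_neg]
  exact w.map_lt_add hx (by rwa [w.map_neg])

theorem val_eq_zero_of_sub_one_pos {w : AddValuation F (WithTop G)} {u : F} (h : 0 < w (u - 1)) :
    w u = 0 := by
  have h1 : w 1 < w (u - 1) := by rwa [w.map_one]
  have := w.map_add_eq_of_lt_right h1
  rwa [sub_add_cancel, w.map_one] at this

theorem val_div_sub_one_pos {w : AddValuation F (WithTop G)} {u u' : F} (h : 0 < w (u - 1))
    (h' : 0 < w (u' - 1)) : 0 < w (u / u' - 1) := by
  have hu : w u' = ((0 : G) : WithTop G) := val_eq_zero_of_sub_one_pos h'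
  rw [div_sub_one (ne_zero_of_val hu), div_eq_mul_inv, w.map_mul, val_inv hu, neg_zero,
    WithTop.coe_zero, add_zero, ← sub_sub_sub_cancel_right u u' 1]
  exact val_lt_sub h h'

/-- Evaluation of a rational function may be computed from any fraction whose denominator does not
vanish at the given point. -/
theorem evalRat_div {p q : K[X]} {x : F} (hx : aeval x q ≠ 0) :
    evalRat (algebraMap K[X] (RatFunc K) p / algebraMap K[X] (RatFunc K) q) x =
      aeval x p / aeval x q := by
  have hq : q ≠ 0 := by rintro rfl; exact hx (map_zero _)
  obtain ⟨d, hd⟩ := RatFunc.denom_div_dvd p q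
  have hden : aeval x (RatFunc.denom (algebraMap K[X] (RatFunc K) p / algebraMap K[X] (RatFunc K) q))
      ≠ 0 := by
    intro h
    apply hx
    rw [hd, map_mul, h, zero_mul]
  have h := (RatFunc.num_mul_eq_mul_denom_iff (p := p) hq).2 rfl
  rw [evalRat, div_eq_div_iff hden hx, ← map_mul, h, map_mul]

variable {I : Type*} [LinearOrder I]

/-- The sequence `f` is eventually obtained by evaluating at `s` a rational function whose value at
`a` is `x`. -/
def Represents (s : I → K) (a : F) (f : I → K) (x : F) : Prop :=
  ∃ p q : K[X], q ≠ 0 ∧ x = aeval a p / aeval a q ∧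
    ∀ᶠ ν in atTop, f ν = p.eval (s ν) / q.eval (s ν)

theorem represents_const (s : I → K) (a : F) (c : K) :
    Represents s a (fun _ => c) (algebraMap K F c) :=
  ⟨C c, 1, one_ne_zero, by simp, by simp⟩

theorem represents_self (s : I → K) (a : F) : Represents s a s a :=
  ⟨X, 1, one_ne_zero, by simp, by simp⟩

theorem exists_represents (s : I → K) {a : F} (hF : K⟮a⟯ = ⊤) (x : F) :
    ∃ f, Represents s a f x := by
  obtain ⟨p, q, rfl⟩ := (IntermediateField.mem_adjoin_simple_iff K x).1
    (hF ▸ IntermediateField.mem_top : x ∈ K⟮a⟯)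
  -- The description of K(a) by quotients allows a zero denominator, where the quotient is 0 by
  -- convention.
  by_cases hq : q = 0
  · refine ⟨fun _ => 0, ?_⟩
    have := represents_const s a 0
    rw [map_zero] at this
    rwa [hq, map_zero, div_zero]
  · exact ⟨_, p, q, hq, rfl, Eventually.of_forall fun _ => rfl⟩

section Field

variable {w : AddValuation F (WithTop G)} {s : I → K} {a : F} {f g : I → K} {x y : F}

theorem Approximates.eval_ne_zero (h : Approximates w s a) {p : K[X]} (hp : p ≠ 0) :
    ∀ᶠ ν in atTop, p.eval (s ν) ≠ 0 := by
  filter_upwards [(h p hp).2] with ν hν h0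
  have := val_eq_zero_of_sub_one_pos hν
  rw [h0, map_zero, zero_div, w.map_zero] at this
  exact WithTop.top_ne_zero this

theorem Represents.add (h : Approximates w s a) (hf : Represents s a f x)
    (hg : Represents s a g y) : Represents s a (f + g) (x + y) := by
  obtain ⟨p, q, hq, rfl, hf⟩ := hf
  obtain ⟨p', q', hq', rfl, hg⟩ := hg
  refine ⟨p * q' + q * p', q * q', mul_ne_zero hq hq', ?_, ?_⟩
  · rw [div_add_div _ _ (h q hq).1 (h q' hq').1]
    simp
  · filter_upwards [hf, hg, h.eval_ne_zero hq, h.eval_ne_zero hq'] with ν h1 h2 h3 h4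
    rw [Pi.add_apply, h1, h2, div_add_div _ _ h3 h4]
    simp

theorem Represents.mul (hf : Represents s a f x) (hg : Represents s a g y) :
    Represents s a (f * g) (x * y) := by
  obtain ⟨p, q, hq, rfl, hf⟩ := hf
  obtain ⟨p', q', hq', rfl, hg⟩ := hg
  refine ⟨p * p', q * q', mul_ne_zero hq hq', ?_, ?_⟩
  · rw [map_mul, map_mul, div_mul_div_comm]
  · filter_upwards [hf, hg] with ν h1 h2
    rw [Pi.mul_apply, h1, h2, eval_mul, eval_mul, div_mul_div_comm]

theorem Represents.inv (hf : Represents s a f x) (hx : x ≠ 0) : Represents s a f⁻¹ x⁻¹ := by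
  obtain ⟨p, q, hq, rfl, hf⟩ := hf
  refine ⟨q, p, ?_, by rw [inv_div], ?_⟩
  · rintro rfl
    simp at hx
  · filter_upwards [hf] with ν h1
    rw [Pi.inv_apply, h1, inv_div]

theorem Represents.smul (hf : Represents s a f x) (c : K) :
    Represents s a (fun ν => c * f ν) (algebraMap K F c * x) :=
  (represents_const s a c).mul hf

theorem Represents.neg (hf : Represents s a f x) : Represents s a (-f) (-x) := by
  have := hf.smul (-1)
  rw [map_neg, map_one, neg_one_mul] at this
  convert this using 1
  ext ν
  simp

theorem Represents.eventually_val_div_sub_one_pos (h : Approximates w s a)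
    (hf : Represents s a f x) (hx : x ≠ 0) :
    ∀ᶠ ν in atTop, 0 < w (algebraMap K F (f ν) / x - 1) := by
  obtain ⟨p, q, hq, rfl, hf⟩ := hf
  have hp : p ≠ 0 := by
    rintro rfl
    simp at hx
  filter_upwards [hf, (h p hp).2, (h q hq).2] with ν h1 h2 h3
  rw [h1, map_div₀, div_div_div_comm]
  exact val_div_sub_one_pos h2 h3

theorem Represents.eventually_val_eq {v : AddValuation K (WithTop G)}
    (hw : ∀ x : K, w (algebraMap K F x) = v x) (h : Approximates w s a)
    (hf : Represents s a f x) : ∀ᶠ ν in atTop, v (f ν) = w x := by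
  by_cases hx : x = 0
  · obtain ⟨p, q, hq, hpq, hf⟩ := hf
    have hp : p = 0 := by
      by_contra hp
      exact div_ne_zero (h p hp).1 (h q hq).1 (hpq ▸ hx)
    filter_upwards [hf] with ν h1
    rw [h1, hp, hx]
    simp
  · filter_upwards [hf.eventually_val_div_sub_one_pos h hx] with ν h1
    have := congrArg (· + w x) (val_eq_zero_of_sub_one_pos h1)
    simp only [zero_add] at this
    rwa [← w.map_mul, div_mul_cancel₀ _ hx, hw] at this

/-- The germ is determined by the element: f - g represents 0, so its value is eventually ∞. -/
theorem Represents.eventually_eq {v : AddValuation K (WithTop G)}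
    (hw : ∀ x : K, w (algebraMap K F x) = v x) (h : Approximates w s a)
    (hf : Represents s a f x) (hg : Represents s a g x) : ∀ᶠ ν in atTop, f ν = g ν := by
  filter_upwards [(hf.add h hg.neg).eventually_val_eq hw h] with ν h1
  rw [add_neg_cancel, w.map_zero, v.top_iff, Pi.add_apply, Pi.neg_apply, ← sub_eq_add_neg] at h1
  exact sub_eq_zero.1 h1

/-- Fractions need not be in lowest terms: a nonzero denominator eventually does not vanish along s,
so the convention at poles is irrelevant. -/
theorem mem_extendedTower [Nonempty I] (h : Approximates w s a) {A : Cut G → Set K} {Γ : Cut G} :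
    x ∈ extendedTower A s a Γ ↔ ∃ f, Represents s a f x ∧ ∀ᶠ ν in atTop, f ν ∈ A Γ := by
  constructor
  · rintro ⟨r, rfl, hr⟩
    refine ⟨fun ν => evalRat r (s ν), ⟨r.num, r.denom, r.denom_ne_zero, rfl, ?_⟩,
      eventually_atTop.2 hr⟩
    simp [evalRat, coe_aeval_eq_eval]
  · rintro ⟨f, ⟨p, q, hq, rfl, hf⟩, hA⟩
    refine ⟨algebraMap K[X] (RatFunc K) p / algebraMap K[X] (RatFunc K) q,
      evalRat_div (h q hq).1, eventually_atTop.1 ?_⟩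
    filter_upwards [hf, hA, h.eval_ne_zero hq] with ν h1 h2 h3
    rw [evalRat_div (by rwa [coe_aeval_eq_eval]), coe_aeval_eq_eval, ← h1]
    exact h2

/-- This says that F is immediate over K; a late term of a sequence representing x serves as b. -/
theorem exists_val_sub_gt [Nonempty I] (h : Approximates w s a)
    (hF : K⟮a⟯ = ⊤) {x : F} (hx : x ≠ 0) :
    ∃ b : K, w x < w (x - algebraMap K F b) := by
  obtain ⟨f, hf⟩ := exists_represents s hF x
  obtain ⟨ν, hν⟩ := (hf.eventually_val_div_sub_one_pos h hx).exists
  refine ⟨f ν, ?_⟩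
  rw [div_sub_one hx] at hν
  rw [w.map_sub_swap, ← div_mul_cancel₀ (algebraMap K F (f ν) - x) hx, w.map_mul]
  have := WithTop.add_lt_add_right (mt w.top_iff.1 hx) hν
  rwa [zero_add] at this

end Field

/-! ### The extended tower and its axioms -/

namespace IsTower

variable {k : Type*} [Field k] [Algebra k K] {v : AddValuation K (WithTop G)} {t : G → K}
  {A : Cut G → Set K}

theorem zero_mem (hA : IsTower k v t A) (Λ : Cut G) : (0 : K) ∈ A Λ := by
  obtain ⟨W, hW⟩ := hA.subspace Λ
  rw [← hW]; exact W.zero_mem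

theorem add_mem (hA : IsTower k v t A) {Λ : Cut G} {x y : K} (hx : x ∈ A Λ) (hy : y ∈ A Λ) :
    x + y ∈ A Λ := by
  obtain ⟨W, hW⟩ := hA.subspace Λ
  rw [← hW] at hx hy ⊢; exact W.add_mem hx hy

theorem smul_mem (hA : IsTower k v t A) {Λ : Cut G} (c : k) {x : K} (hx : x ∈ A Λ) :
    algebraMap k K c * x ∈ A Λ := by
  obtain ⟨W, hW⟩ := hA.subspace Λ
  rw [← hW] at hx ⊢
  rw [← Algebra.smul_def]
  exact W.smul_mem c hx

theorem neg_mem (hA : IsTower k v t A) {Λ : Cut G} {x : K} (hx : x ∈ A Λ) : -x ∈ A Λ := by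
  obtain ⟨W, hW⟩ := hA.subspace Λ
  rw [← hW] at hx ⊢; exact W.neg_mem hx

theorem eq_zero (hA : IsTower k v t A) {Λ : Cut G} {x : K} (hx : x ∈ A Λ)
    (hx' : x ∈ idealOf v Λ) : x = 0 :=
  congrArg Prod.fst ((hA.direct_sum Λ x).unique (y₁ := (x, 0)) (y₂ := (0, x))
    ⟨hx, zero_mem_idealOf v Λ, add_zero x⟩ ⟨hA.zero_mem Λ, hx', zero_add x⟩)

theorem exists_decomp (hA : IsTower k v t A) (Λ : Cut G) (x : K) :
    ∃ y ∈ A Λ, ∃ z ∈ idealOf v Λ, x = y + z := by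
  obtain ⟨⟨y, z⟩, ⟨h1, h2, h3⟩, -⟩ := hA.direct_sum Λ x
  exact ⟨y, h1, z, h2, h3.symm⟩

theorem mono (hA : IsTower k v t A) {Λ Γ : Cut G} (h : Λ ≤ Γ) {x : K} (hx : x ∈ A Λ) : x ∈ A Γ :=
  (hA.le_iff_subset Λ Γ).1 h hx

theorem t_mem (hA : IsTower k v t A) (γ : G) : t γ ∈ A (Cut.plus γ) := by
  have := hA.monomial_mem γ 1
  rwa [map_one, mul_one] at this

/-- The section t need not be a homomorphism, but t(-0) = t(0)⁻¹ forces t(0) = ±1. -/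
theorem one_mem (hA : IsTower k v t A) (hsec : HasSections k v t) {Δ : Cut G} (h0 : (0 : G) ∈ Δ) :
    (1 : K) ∈ A Δ := by
  have h1 : t 0 * t 0 = 1 := by
    have h2 := hsec.t_neg 0
    rw [neg_zero] at h2
    nth_rewrite 2 [h2]
    exact mul_inv_cancel₀ (ne_zero_of_val (hsec.val_t 0))
  refine hA.mono (fun x hx => Δ.lower (mem_plus.1 hx) h0) (Λ := Cut.plus 0) ?_
  rcases mul_self_eq_one_iff.1 h1 with h | h
  · exact h ▸ hA.t_mem 0
  · have := hA.neg_mem (hA.t_mem 0)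
    rwa [h, neg_neg] at this

/-- The complement at an additively closed cut is closed under inverses of elements of value `0`. -/
theorem inv_mem (hA : IsTower k v t A) (hsec : HasSections k v t) {Δ : Cut G} (h0 : (0 : G) ∈ Δ)
    (hΔ : Cut.leftSum Δ Δ ≤ Δ) {x : K} (hx : x ∈ A Δ) (hx0 : v x = 0) : x⁻¹ ∈ A Δ := by
  have hne : x ≠ 0 := ne_zero_of_val (γ := 0) hx0
  -- With x⁻¹ = y + z split at Δ, the product xz = 1 - xy lies in A[Δ], and in O[Δ] since v(x) = 0.
  -- Hence z = 0.
  obtain ⟨y, hy, z, hz, h⟩ := hA.exists_decomp Δ x⁻¹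
  have hxz : x * z = 0 := by
    refine hA.eq_zero (Λ := Δ) ?_ fun γ hγ => ?_
    · have h1 : x * z = 1 + -(x * y) := by
        rw [← mul_inv_cancel₀ hne, h]; ring
      rw [h1]
      exact hA.add_mem (hA.one_mem hsec h0) (hA.neg_mem (hA.mono hΔ (hA.mul_mem Δ Δ x hx y hy)))
    · rw [v.map_mul, hx0, zero_add]
      exact hz γ hγ
  rw [h, (mul_eq_zero.1 hxz).resolve_left hne, add_zero]
  exact hy

variable [Nonempty I] {w : AddValuation F (WithTop G)} {s : I → K} {a : F}

/-- The extended tower as a family of additive groups. -/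
def extendedGroup (hA : IsTower k v t A) (h : Approximates w s a) (Γ : Cut G) : AddSubgroup F where
  carrier := extendedTower A s a Γ
  add_mem' := fun {x y} hx hy => by
    obtain ⟨f, hf, hfA⟩ := (mem_extendedTower h).1 hx
    obtain ⟨g, hg, hgA⟩ := (mem_extendedTower h).1 hy
    refine (mem_extendedTower h).2 ⟨_, hf.add h hg, ?_⟩
    filter_upwards [hfA, hgA] with ν h1 h2 using hA.add_mem h1 h2
  zero_mem' := by
    refine (mem_extendedTower h).2 ⟨_, map_zero (algebraMap K F) ▸ represents_const s a 0, ?_⟩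
    exact Eventually.of_forall fun _ => hA.zero_mem Γ
  neg_mem' := fun {x} hx => by
    obtain ⟨f, hf, hfA⟩ := (mem_extendedTower h).1 hx
    refine (mem_extendedTower h).2 ⟨_, hf.neg, ?_⟩
    filter_upwards [hfA] with ν h1 using hA.neg_mem h1

theorem algebraMap_mem_extendedTower (h : Approximates w s a) {Γ : Cut G} {c : K} (hc : c ∈ A Γ) :
    algebraMap K F c ∈ extendedTower A s a Γ :=
  (mem_extendedTower h).2 ⟨_, represents_const s a c, Eventually.of_forall fun _ => hc⟩

theorem mul_mem_extendedTower (hA : IsTower k v t A) (h : Approximates w s a) {Λ Γ : Cut G}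
    {x y : F} (hx : x ∈ extendedTower A s a Λ) (hy : y ∈ extendedTower A s a Γ) :
    x * y ∈ extendedTower A s a (Cut.leftSum Λ Γ) := by
  obtain ⟨f, hf, hfA⟩ := (mem_extendedTower h).1 hx
  obtain ⟨g, hg, hgA⟩ := (mem_extendedTower h).1 hy
  refine (mem_extendedTower h).2 ⟨_, hf.mul hg, ?_⟩
  filter_upwards [hfA, hgA] with ν h1 h2 using hA.mul_mem Λ Γ _ h1 _ h2

theorem extendedTower_mono (hA : IsTower k v t A) (h : Approximates w s a) {Λ Γ : Cut G}
    (hle : Λ ≤ Γ) : extendedTower A s a Λ ⊆ extendedTower A s a Γ := fun x hx => by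
  obtain ⟨f, hf, hfA⟩ := (mem_extendedTower h).1 hx
  exact (mem_extendedTower h).2 ⟨f, hf, hfA.mono fun ν => hA.mono hle⟩

theorem preimage_extendedTower (hw : ∀ x : K, w (algebraMap K F x) = v x)
    (h : Approximates w s a) (Γ : Cut G) :
    algebraMap K F ⁻¹' extendedTower A s a Γ = A Γ := by
  ext c
  refine ⟨fun hc => ?_, algebraMap_mem_extendedTower h⟩
  obtain ⟨f, hf, hfA⟩ := (mem_extendedTower h).1 hc
  obtain ⟨ν, h1, h2⟩ := ((hf.eventually_eq hw h (represents_const s a c)).and hfA).exists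
  exact h1 ▸ h2

theorem isPreTower_extendedGroup (hA : IsTower k v t A) (hsec : HasSections k v t)
    (hw : ∀ x : K, w (algebraMap K F x) = v x) (h : Approximates w s a) :
    IsPreTower w (hA.extendedGroup h) where
  mono := fun _ _ hle => hA.extendedTower_mono h hle
  eq_zero := fun {Λ x} hx hx' => by
    obtain ⟨f, hf, hfA⟩ := (mem_extendedTower h).1 hx
    obtain ⟨ν, h1, h2⟩ := (hfA.and (hf.eventually_val_eq hw h)).exists
    have h3 : f ν = 0 := hA.eq_zero h1 fun γ hγ => by rw [h2]; exact hx' γ hγ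
    rw [h3, v.map_zero] at h2
    exact w.top_iff.1 h2.symm
  mul_mem := hA.mul_mem_extendedTower h
  exists_monomial := fun γ =>
    ⟨algebraMap K F (t γ), algebraMap_mem_extendedTower h (hA.t_mem γ), by rw [hw, hsec.val_t]⟩
  inv_mem := fun {Δ x} h0 hΔ hx hx0 => by
    obtain ⟨f, hf, hfA⟩ := (mem_extendedTower h).1 hx
    refine (mem_extendedTower h).2 ⟨_, hf.inv (ne_zero_of_val (γ := 0) hx0), ?_⟩
    filter_upwards [hfA, hf.eventually_val_eq hw h] with ν h1 h2
    exact hA.inv_mem hsec h0 hΔ h1 (h2.trans hx0)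

theorem truncatable_extendedGroup (hA : IsTower k v t A) (hsec : HasSections k v t)
    (hw : ∀ x : K, w (algebraMap K F x) = v x) (h : Approximates w s a) (hF : K⟮a⟯ = ⊤)
    (hs : ∀ ν, s ν ∈ A (approxCut K w a)) (x : F) : Truncatable w (hA.extendedGroup h) x := by
  have hC := hA.isPreTower_extendedGroup hsec hw h
  have hK : ∀ c : K, Truncatable w (hA.extendedGroup h) (algebraMap K F c) := fun c Γ => by
    obtain ⟨y, hy, z, hz, rfl⟩ := hA.exists_decomp Γ c
    refine ⟨algebraMap K F y, algebraMap_mem_extendedTower h hy, fun γ hγ => ?_⟩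
    rw [← map_sub, hw, add_sub_cancel_left]
    exact hz γ hγ
  have ha : Truncatable w (hA.extendedGroup h) a := fun Γ => by
    by_cases hle : approxCut K w a ≤ Γ
    · refine ⟨a, isTrunc_self ((mem_extendedTower h).2 ⟨s, represents_self s a, ?_⟩)⟩
      exact Eventually.of_forall fun ν => hA.mono hle (hs ν)
    -- Some c ∈ K is so close to a that a - c ∈ O[Γ]; the truncation of c at Γ is then one of a.
    · obtain ⟨δ, hδ, hδΓ⟩ := Set.not_subset.1 hle
      obtain ⟨c, hc, -⟩ := mem_approxCut.1 hδ
      obtain ⟨y, hy⟩ := hK c Γ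
      refine ⟨y, hy.1, ?_⟩
      have h1 : a - algebraMap K F c ∈ idealOf w Γ :=
        mem_idealOf_of_le hδΓ (by rwa [w.map_sub_swap])
      have := add_mem_idealOf h1 hy.2
      rwa [sub_add_sub_cancel] at this
  let R : IntermediateField K F := hC.truncatableSubfield.toIntermediateField hK
  have hR : K⟮a⟯ ≤ R := IntermediateField.adjoin_simple_le_iff.2 ha
  rw [hF] at hR
  exact hR IntermediateField.mem_top

end IsTower

/-- Each x with w(x) ≥ 0 has the same residue as some b ∈ K, so existence and uniqueness of its
representative in k carry over from b. -/
theorem hasSections_of_immediate {k : Type*} [Field k] [Algebra k K] [Algebra k F]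
    [IsScalarTower k K F] {v : AddValuation K (WithTop G)} {t : G → K} (hsec : HasSections k v t)
    {w : AddValuation F (WithTop G)} (hw : ∀ x : K, w (algebraMap K F x) = v x)
    (himm : ∀ x : F, x ≠ 0 → ∃ b : K, w x < w (x - algebraMap K F b)) :
    HasSections k w (fun γ => algebraMap K F (t γ)) where
  residue_nonneg := fun c => by
    rw [IsScalarTower.algebraMap_apply k K F, hw]
    exact hsec.residue_nonneg c
  residue_section := fun x hx => by
    have key : ∃ b : K, 0 < w (x - algebraMap K F b) := by
      by_cases hx0 : x = 0
      · exact ⟨0, by simp [hx0]⟩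
      · obtain ⟨b, hb⟩ := himm x hx0
        exact ⟨b, hx.trans_lt hb⟩
    obtain ⟨b, hb⟩ := key
    have hiff : ∀ c : k, 0 < w (x - algebraMap k F c) ↔ 0 < v (b - algebraMap k K c) := fun c => by
      rw [← hw, map_sub (algebraMap K F), ← IsScalarTower.algebraMap_apply k K F]
      constructor <;> intro h
      · have := val_lt_sub h hb
        rwa [sub_sub_sub_cancel_left] at this
      · have := w.map_lt_add hb h
        rwa [sub_add_sub_cancel] at this
    have hb0 : 0 ≤ v b := by
      rw [← hw, ← sub_sub_cancel x (algebraMap K F b)]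
      exact w.map_le_sub hx hb.le
    simp only [hiff]
    exact hsec.residue_section b hb0
  val_t := fun γ => by rw [hw, hsec.val_t]
  t_neg := fun γ => by rw [hsec.t_neg, map_inv₀]

theorem isTower_extendedTower [Nonempty I] {k : Type*} [Field k] [Algebra k K] [Algebra k F]
    [IsScalarTower k K F] {v : AddValuation K (WithTop G)} {t : G → K} (hsec : HasSections k v t)
    {A : Cut G → Set K} (hA : IsTower k v t A)
    {w : AddValuation F (WithTop G)} (hw : ∀ x : K, w (algebraMap K F x) = v x)
    {s : I → K} {a : F} (h : Approximates w s a) (hF : K⟮a⟯ = ⊤)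
    (hs : ∀ ν, s ν ∈ A (approxCut K w a)) :
    IsTower k w (fun γ => algebraMap K F (t γ)) (extendedTower A s a) where
  subspace := fun Λ => by
    refine ⟨{ hA.extendedGroup h Λ with smul_mem' := fun c x hx => ?_ }, rfl⟩
    obtain ⟨f, hf, hfA⟩ := (mem_extendedTower h).1 hx
    rw [Algebra.smul_def, IsScalarTower.algebraMap_apply k K F]
    exact (mem_extendedTower h).2 ⟨_, hf.smul _, hfA.mono fun ν => hA.smul_mem c⟩
  direct_sum := fun Λ x => by
    have hC := hA.isPreTower_extendedGroup hsec hw h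
    obtain ⟨y, hy⟩ := hA.truncatable_extendedGroup hsec hw h hF hs x Λ
    refine ⟨(y, x - y), ⟨hy.1, hy.2, add_sub_cancel y x⟩, ?_⟩
    rintro ⟨y', z⟩ ⟨h1, h2, rfl⟩
    have : y' = y := hC.trunc_unique ⟨h1, by simpa using h2⟩ hy
    simp [← this]
  monomial_mem := fun γ c => by
    rw [IsScalarTower.algebraMap_apply k K F, ← map_mul]
    exact IsTower.algebraMap_mem_extendedTower h (hA.monomial_mem γ c)
  le_iff_subset := fun Γ Λ => by
    -- Inclusions between the new complements are reflected by intersecting with K, which gives back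
    -- the old ones.
    refine ⟨hA.extendedTower_mono h, fun hle => (hA.le_iff_subset Γ Λ).2 ?_⟩
    rw [← IsTower.preimage_extendedTower (A := A) hw h Γ,
      ← IsTower.preimage_extendedTower (A := A) hw h Λ]
    exact Set.preimage_mono hle
  mul_mem := fun Λ Γ x hx y hy => hA.mul_mem_extendedTower h hx hy

end Extension

end TowerComplements

open TowerComplements in
theorem mainTheorem9
    {G : Type*} [AddCommGroup G] [LinearOrder G] [IsOrderedAddMonoid G]
    {k K F : Type*} [Field k] [Field K] [Field F]
    [Algebra k K] [Algebra K F] [Algebra k F] [IsScalarTower k K F]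
    -- the valued field `(K, v)` with its sections, and a tower of complements `A` for it
    (v : AddValuation K (WithTop G)) (t : G → K) (hsec : HasSections k v t)
    (A : Cut G → Set K) (hA : IsTower k v t A)
    -- the valued field extension `F = K(a)`
    (w : AddValuation F (WithTop G)) (hw : ∀ x : K, w (algebraMap K F x) = v x)
    (a : F) (hF : K⟮a⟯ = ⊤)
    -- a pseudo Cauchy sequence of transcendental type in `K` with limit `a`
    {I : Type*} [LinearOrder I] [WellFoundedLT I] [Nonempty I] [NoMaxOrder I]
    (s : I → K) (hs : IsPseudoCauchy v s) (htr : IsTranscendentalType v s)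
    (ha : IsPseudoLimit w s a)
    -- the components `s' ν` of the `s ν` in the complement at the cut of `a`
    (s' : I → K) (hs' : ∀ ν, s' ν ∈ A (approxCut K w a))
    (hss' : ∀ ν, s ν - s' ν ∈ idealOf v (approxCut K w a)) :
    HasSections k w (fun γ => algebraMap K F (t γ)) ∧
    IsTower k w (fun γ => algebraMap K F (t γ)) (extendedTower A s' a) ∧
    ∀ Γ : Cut G, algebraMap K F ⁻¹' extendedTower A s' a Γ = A Γ := by
  have h := approximates_of_sub_mem hw hs htr ha hss'
  exact ⟨hasSections_of_immediate hsec hw fun _ => exists_val_sub_gt h hF,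
    isTower_extendedTower hsec hA hw h hF hs', IsTower.preimage_extendedTower hw h⟩
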